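/- Let $M$ be a von Neumann algebra on a separable Hilbert space with a faithful normal semifinite trace $\tau$. Let $M_*$ be the space of $\sigma$-weakly continuous functionals on $M$; it is identified with $L^1(M,\tau)$ through $X \leftrightarrow \tau(X\,\cdot)$. Let $G$ be a locally compact second countable Hausdorff semigroup with a $\sigma$-finite Borel measure $m$ such that $m(uB)=m(B)=m(Bu)$ for all $u\in G$ and Borel sets $B$, and let $(K_n)_{n\in\mathbb N}$ be a Følner sequence: the $K_n$ are measurable, $0<m(K_n)<\infty$, and $m(K_n\,\Delta\,K_ng)/m(K_n)\to0$ and $m(K_n\,\Delta\,gK_n)/m(K_n)\to0$ for all $g\in G$. Let $(M,G,\alpha)$ be a non-commutative dynamical system: $\alpha$ is an action or an anti-action of $G$ on $M$ by normal positive contractions $\alpha_g$ with $\alpha_g(1)\le 1$, and $g\mapsto\alpha_g(x)$ is weak* continuous for every $x\in M$. Let $\alpha_g^*:L^1(M,\tau)\to L^1(M,\tau)$ be given by $\tau(\alpha_g^*(X)y)=\tau(X\alpha_g(y))$ for $y\in M$. The support $s(X)$ of $X\in L^1(M,\tau)$ is the smallest projection $p\in M$ with $pX=X=Xp$; likewise,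 the support of a positive $x\in M$ is the smallest projection $p\in M$ with $px=x$, and the support of $\rho\in M_*$ is that of the corresponding element of $L^1(M,\tau)$. Let $e_1,e_2\in M$ be the projections of the Neveu decomposition: $e_1+e_2=1$; $e_1$ is the support of a $G$-invariant positive normal functional $\rho$ on $M$ (so either $e_1=0$, or $e_1$ is the support of a $G$-invariant normal state); and $e_2$ is the support of a weakly wandering operator, i.e. of a positive $x_0\in M$ such that the weak* integrals $A_n(x_0)=\frac1{m(K_n)}\int_{K_n}\alpha_g(x_0)\,dm(g)$ satisfy $\|A_n(x_0)\|\to0$. Then $$\alpha_g(e_2)\le e_2\quad\text{and}\quad s\big(\alpha_g^*(e_1Xe_1)\big)\le e_1\qquad\text{for all }X\in L^1(M,\tau),\ g\in G.$$ If moreover every $\alpha_g^*$ is a Lamperti operator on $L^1(M,\tau)$, i.e. $\alpha_g^*(p)\,\alpha_g^*(q)=0$ for all projections $p,q\in M$ with $\tau(p),\tau(q)<\infty$ and $pq=0$, then also $\alpha_g(e_1)\le e_1$ for all $g\in G$. -/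

import Mathlib

open Filter Topology MeasureTheory
open scoped ENNReal NNReal ComplexOrder

/-- The von Neumann algebra `M ⊆ B(H)` as a type. It carries the operator norm, the adjoint and the
order of operators (`x ≤ y` iff `y - x` is a positive operator). -/
abbrev VNElem {H : Type*} [NormedAddCommGroup H] [InnerProductSpace ℂ H] [CompleteSpace H]
    (M : VonNeumannAlgebra H) : Type _ :=
  M.toStarSubalgebra

section Functionals

variable {H : Type*} [NormedAddCommGroup H] [InnerProductSpace ℂ H] [CompleteSpace H]
  {M : VonNeumannAlgebra H}

/-- `φ ∈ M_*`: the functional `φ` on `M` is `σ`-weakly continuous, that is,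
`φ(x) = ∑ ⟨x ξₙ, ηₙ⟩` with `∑ ‖ξₙ‖² < ∞` and `∑ ‖ηₙ‖² < ∞`. (Mathlib's inner product is conjugate
linear in the first variable.) The space `M_*` of these functionals, with the norm of the dual of
`M`, is identified with `L¹(M, τ)` by `X ↦ τ(X ·)`. -/
def IsNormalFunctional (φ : StrongDual ℂ (VNElem M)) : Prop :=
  ∃ ξ η : ℕ → H, (Summable fun n => ‖ξ n‖ ^ 2) ∧ (Summable fun n => ‖η n‖ ^ 2) ∧
    ∀ x : VNElem M, φ x = ∑' n, inner ℂ (η n) ((x : H →L[ℂ] H) (ξ n))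

/-- Positivity of a functional: `φ(x* x) ≥ 0` for all `x`. -/
def IsPositiveFunctional (φ : StrongDual ℂ (VNElem M)) : Prop :=
  ∀ x : VNElem M, 0 ≤ φ (star x * x)

/-- `s` is the support of the self-adjoint operator `x ∈ M`: the smallest projection of `M` with
`s x = x`. -/
def IsOperatorSupport (x s : VNElem M) : Prop :=
  IsLeast {p : VNElem M | IsStarProjection p ∧ p * x = x} s

/-- `s` is the support of `φ ∈ M_*`: the smallest projection `p` of `M` with
`φ(x p) = φ(x) = φ(p x)` for all `x ∈ M`. For `φ = τ(X ·)` with `X ∈ L¹(M, τ)` these equations say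
`p X = X = X p`, so `s` is the support of `X`. For a positive normal `φ` they say `φ(1 - p) = 0`, so
`1 - s` is the largest projection on which `φ` vanishes. -/
def IsFunctionalSupport (φ : StrongDual ℂ (VNElem M)) (s : VNElem M) : Prop :=
  IsLeast {p : VNElem M | IsStarProjection p ∧ ∀ x, φ (x * p) = φ x ∧ φ (p * x) = φ x} s

/-- For `φ = τ(X ·)`, this is the functional `τ(e X f ·)`, i.e. `x ↦ φ(f x e)`. -/
noncomputable def compress (e f : VNElem M) (φ : StrongDual ℂ (VNElem M)) :
    StrongDual ℂ (VNElem M) :=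
  φ.comp ((ContinuousLinearMap.mul ℂ (VNElem M) f).comp
    ((ContinuousLinearMap.mul ℂ (VNElem M)).flip e))

/-- The dual map `T^*` of `T : M → M`, `T^*(φ) = φ ∘ T`. If `T` is normal, then `T^*` maps `M_*` to
itself. -/
noncomputable def dualMap (T : VNElem M →L[ℂ] VNElem M) :
    StrongDual ℂ (VNElem M) →ₗ[ℂ] StrongDual ℂ (VNElem M) where
  toFun φ := φ.comp T
  map_add' _ _ := rfl
  map_smul' _ _ := rfl

/-- For positive `A, B ∈ L¹(M, τ)` with `φ = τ(A ·)` and `ψ = τ(B ·)`, this says `A B = 0`: the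
supports of `A` and `B` are orthogonal. -/
def HaveZeroProduct (φ ψ : StrongDual ℂ (VNElem M)) : Prop :=
  ∃ s t : VNElem M, IsFunctionalSupport φ s ∧ IsFunctionalSupport ψ t ∧ s * t = 0

end Functionals

section Trace

variable {H : Type*} [NormedAddCommGroup H] [InnerProductSpace ℂ H] [CompleteSpace H]

/-- A faithful normal semifinite trace `τ : M₊ → [0, ∞]`. Only the values at positive elements
matter. -/
structure FNSTrace (M : VonNeumannAlgebra H) where
  /-- the value of the trace (meaningful at positive elements) -/
  toFun : VNElem M → ℝ≥0∞
  map_add : ∀ x y : VNElem M, 0 ≤ x → 0 ≤ y → toFun (x + y) = toFun x + toFun y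
  map_smul : ∀ (c : ℝ≥0) (x : VNElem M), 0 ≤ x → toFun (((c : ℝ) : ℂ) • x) = c * toFun x
  tracial : ∀ x : VNElem M, toFun (star x * x) = toFun (x * star x)
  faithful : ∀ x : VNElem M, 0 ≤ x → toFun x = 0 → x = 0
  normal : ∀ (D : Set (VNElem M)) (x : VNElem M), D.Nonempty → DirectedOn (· ≤ ·) D →
    (∀ y ∈ D, 0 ≤ y) → IsLUB D x → toFun x = ⨆ y ∈ D, toFun y
  semifinite : ∀ x : VNElem M, 0 ≤ x → x ≠ 0 →
    ∃ y : VNElem M, 0 ≤ y ∧ y ≤ x ∧ y ≠ 0 ∧ toFun y < ∞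

variable {M : VonNeumannAlgebra H}

/-- `φ` is the functional `τ(p ·)` of a projection `p` with `τ(p) < ∞`: `φ(x) = τ(p x p)` for all
`x ≥ 0` (hence for all `x` by linearity). -/
def IsTraceFunctional (τ : FNSTrace M) (p : VNElem M) (φ : StrongDual ℂ (VNElem M)) : Prop :=
  ∀ x : VNElem M, 0 ≤ x → φ x = (((τ.toFun (p * x * p)).toReal : ℝ) : ℂ)

/-- `γ` is Lamperti: `γ(p) γ(q) = 0` for all projections `p, q ∈ L¹(M, τ)` (i.e. of finite trace)
with `p q = 0`. -/
def IsLamperti (τ : FNSTrace M)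
    (γ : StrongDual ℂ (VNElem M) →ₗ[ℂ] StrongDual ℂ (VNElem M)) : Prop :=
  ∀ p q : VNElem M, IsStarProjection p → IsStarProjection q →
    τ.toFun p < ∞ → τ.toFun q < ∞ → p * q = 0 →
    ∀ φ ψ : StrongDual ℂ (VNElem M), IsTraceFunctional τ p φ → IsTraceFunctional τ q ψ →
      HaveZeroProduct (γ φ) (γ ψ)

/-- The class of positive Lamperti contractions of `L¹(M, τ) = M_*`. -/
def lampertiClass (τ : FNSTrace M) :
    Set (StrongDual ℂ (VNElem M) →ₗ[ℂ] StrongDual ℂ (VNElem M)) :=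
  {γ | (∀ φ, IsNormalFunctional φ → IsNormalFunctional (γ φ)) ∧
    (∀ φ, IsNormalFunctional φ → IsPositiveFunctional φ → IsPositiveFunctional (γ φ)) ∧
    (∀ φ, IsNormalFunctional φ → ‖γ φ‖ ≤ ‖φ‖) ∧
    IsLamperti τ γ}

end Trace

section Amenable

variable {G : Type*} [Semigroup G] [MeasurableSpace G]

/-- Invariance of a measure on a semigroup: `m(uB) = m(B) = m(Bu)` for Borel sets `B`. -/
def IsTwoSidedInvariant (m : Measure G) : Prop :=
  ∀ (u : G) (B : Set G), MeasurableSet B →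
    m ((fun h => u * h) '' B) = m B ∧ m ((fun h => h * u) '' B) = m B

/-- A two-sided Følner sequence of measurable sets. -/
structure IsFolnerSequence (m : Measure G) (K : ℕ → Set G) : Prop where
  measurableSet : ∀ n, MeasurableSet (K n)
  measure_pos : ∀ n, 0 < m (K n)
  measure_lt_top : ∀ n, m (K n) < ∞
  right : ∀ g : G,
    Tendsto (fun n => m (symmDiff (K n) ((fun h => h * g) '' K n)) / m (K n)) atTop (𝓝 0)
  left : ∀ g : G,
    Tendsto (fun n => m (symmDiff (K n) ((fun h => g * h) '' K n)) / m (K n)) atTop (𝓝 0)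

end Amenable

section Dynamics

variable {H : Type*} [NormedAddCommGroup H] [InnerProductSpace ℂ H] [CompleteSpace H]
  {M : VonNeumannAlgebra H} {G : Type*} [Semigroup G]

/-- A non-commutative dynamical system `(M, G, α)`: an action or anti-action of `G` on `M` by
normal positive contractions with `α_g(1) ≤ 1`, such that `g ↦ α_g(x)` is weak* continuous. -/
structure IsNCDynamicalSystem [TopologicalSpace G] (α : G → VNElem M →L[ℂ] VNElem M) : Prop where
  action_or_antiaction :
    (∀ g h, α (g * h) = (α g).comp (α h)) ∨ (∀ g h, α (g * h) = (α h).comp (α g))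
  continuous : ∀ (x : VNElem M) (φ : StrongDual ℂ (VNElem M)), IsNormalFunctional φ →
    Continuous fun g => φ (α g x)
  contraction : ∀ g, ‖α g‖ ≤ 1
  positive : ∀ g (x : VNElem M), 0 ≤ x → 0 ≤ α g x
  map_one_le : ∀ g, α g 1 ≤ 1
  normal : ∀ g (φ : StrongDual ℂ (VNElem M)), IsNormalFunctional φ →
    IsNormalFunctional (φ.comp (α g))

/-- `a = (1 / m(K)) ∫_K α_g(x) dm(g)` as a weak* integral. -/
def IsAverage [MeasurableSpace G] (m : Measure G) (K : Set G) (α : G → VNElem M →L[ℂ] VNElem M)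
    (x a : VNElem M) : Prop :=
  ∀ φ : StrongDual ℂ (VNElem M), IsNormalFunctional φ →
    φ a = ((m.real K : ℝ) : ℂ)⁻¹ * ∫ g in K, φ (α g x) ∂m

/-- `x ∈ M₊` is weakly wandering: its averages `A_n(x)` over the sets `K n` tend to `0` in norm. -/
def IsWeaklyWandering [MeasurableSpace G] (m : Measure G) (K : ℕ → Set G)
    (α : G → VNElem M →L[ℂ] VNElem M) (x : VNElem M) : Prop :=
  0 ≤ x ∧ ∃ A : ℕ → VNElem M, (∀ n, IsAverage m (K n) α x (A n)) ∧
    Tendsto (fun n => ‖A n‖) atTop (𝓝 0)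

/-- `e₁, e₂` are the projections of the Neveu decomposition of `(M, G, α)`: `e₁ + e₂ = 1`, `e₁` is
the support of a `G`-invariant positive normal functional (equivalently, `e₁ = 0` or `e₁` is the
support of a `G`-invariant normal state), and `e₂` is the support of a weakly wandering operator. -/
structure IsNeveuDecomposition [MeasurableSpace G] (m : Measure G) (K : ℕ → Set G)
    (α : G → VNElem M →L[ℂ] VNElem M) (e₁ e₂ : VNElem M) : Prop where
  add_eq_one : e₁ + e₂ = 1
  exists_invariant : ∃ ρ : StrongDual ℂ (VNElem M), IsNormalFunctional ρ ∧
    IsPositiveFunctional ρ ∧ (∀ g x, ρ (α g x) = ρ x) ∧ IsFunctionalSupport ρ e₁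
  exists_wandering : ∃ x₀ : VNElem M, IsWeaklyWandering m K α x₀ ∧ IsOperatorSupport x₀ e₂

end Dynamics

/-! ### Square roots and kernel projections inside `M`. -/

section Algebra

variable {H : Type*} [NormedAddCommGroup H] [InnerProductSpace ℂ H] [CompleteSpace H]
  {M : VonNeumannAlgebra H}

/-! The invariant functional `ρ` is faithful on the corner of its support `e₁`: a positive `a` with
`ρ a = 0` satisfies `a * e₁ = 0` (`IsFunctionalSupport.mul_eq_zero`). Since `ρ (α g e₂) = ρ e₂ = 0`,
this gives `α g e₂ * e₁ = 0`, and a positive `a ≤ 1` with `a * e₁ = 0` is at most `1 - e₁ = e₂`.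

For the dual maps, Cauchy-Schwarz applied to the positive functionals `y ↦ ⟨v, e₁ α_g(y) e₁ v⟩`
improves this to `e₁ α_g(e₂ x) e₁ = 0 = e₁ α_g(x e₂) e₁` (`conj_map_mul_eq_zero`). Hence `X(e₁
α_g(·) e₁)` does not see `e₂`, and its support lies under `e₁`.

In the Lamperti case, let `q ≤ e₂` be a projection of finite trace and `t` the support of
`α_g^*(q)`. For each projection `p ≤ e₁` of finite trace, the support of `α_g^*(p)` is orthogonal to
`t`, so `τ(p α_g(t) p) = 0` and `p α_g(t) p = 0`. Semifiniteness gives `e₁ α_g(t) e₁ = 0`, so `ρ(t)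
= ρ(α_g(t)) = 0` and `t e₁ = 0`. Thus `τ(q α_g(e₁) q) = 0`; varying `q` gives `e₂ α_g(e₁) e₂ = 0`,
that is, `α_g(e₁) ≤ e₁`.

Faithfulness and the existence of supports rest on the mean ergodic theorem: for `0 ≤ b ≤ 1` the
Cesàro means of the powers of `1 - b` converge strongly to the projection onto `ker b`, and normal
functionals respect this limit. -/

theorem VonNeumannAlgebra.mem_of_forall_commute {x : H →L[ℂ] H}
    (h : ∀ y ∈ M.commutant, Commute x y) : x ∈ M.toStarSubalgebra := by
  have : x ∈ M.commutant.commutant :=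
    VonNeumannAlgebra.mem_commutant_iff.2 fun y hy => (h y hy).symm
  rwa [VonNeumannAlgebra.commutant_commutant] at this

theorem VonNeumannAlgebra.commute_of_mem {x y : H →L[ℂ] H} (hx : x ∈ M.toStarSubalgebra)
    (hy : y ∈ M.commutant) : Commute x y :=
  VonNeumannAlgebra.mem_commutant_iff.1 hy x hx

theorem VNElem.isClosed (M : VonNeumannAlgebra H) :
    IsClosed (M.toStarSubalgebra : Set (H →L[ℂ] H)) := by
  have : (M.toStarSubalgebra : Set (H →L[ℂ] H)) = ⋂ y ∈ M.commutant, {x | x * y = y * x} := by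
    ext x
    simp only [Set.mem_iInter]
    exact ⟨fun hx y hy => M.commute_of_mem hx hy, fun h => M.mem_of_forall_commute h⟩
  rw [this]
  exact isClosed_biInter fun y _ => isClosed_eq (by fun_prop) (by fun_prop)

attribute [local instance] VNElem.isClosed

theorem VNElem.nonneg_iff_exists {x : VNElem M} : 0 ≤ x ↔ ∃ y, x = star y * y := by
  constructor
  · intro hx
    have hx' : (0 : H →L[ℂ] H) ≤ x := hx
    -- The functional calculus of `x` commutes with everything that commutes with `x`, so by the
    -- bicommutant theorem the square root stays in `M`.
    have hmem : CFC.sqrt (x : H →L[ℂ] H) ∈ M.toStarSubalgebra := by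
      refine M.mem_of_forall_commute fun y hy => ?_
      rw [CFC.sqrt_eq_real_sqrt _ hx']
      exact IsSelfAdjoint.commute_cfcₙ (IsSelfAdjoint.of_nonneg hx') (M.commute_of_mem x.2 hy) _
    refine ⟨⟨_, hmem⟩, Subtype.ext ?_⟩
    have h1 : star (CFC.sqrt (x : H →L[ℂ] H)) = CFC.sqrt (x : H →L[ℂ] H) :=
      IsSelfAdjoint.of_nonneg (CFC.sqrt_nonneg _)
    have h2 := CFC.sqrt_mul_sqrt_self (x : H →L[ℂ] H) hx'
    calc (x : H →L[ℂ] H) = star (CFC.sqrt (x : H →L[ℂ] H)) * CFC.sqrt (x : H →L[ℂ] H) := by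
          rw [h1, h2]
      _ = _ := rfl
  · rintro ⟨y, rfl⟩
    exact star_mul_self_nonneg (y : H →L[ℂ] H)

theorem VNElem.starOrderedRing : StarOrderedRing (VNElem M) :=
  .of_nonneg_iff' (fun h z => add_le_add_right h z) fun _ => VNElem.nonneg_iff_exists

attribute [local instance] VNElem.starOrderedRing

theorem VNElem.eq_zero_of_forall_inner {x : VNElem M}
    (h : ∀ v : H, inner ℂ ((x : H →L[ℂ] H) v) v = 0) : x = 0 := by
  have := (inner_map_self_eq_zero ((x : H →L[ℂ] H) : H →ₗ[ℂ] H)).1 h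
  refine Subtype.ext (ContinuousLinearMap.ext fun v => ?_)
  exact LinearMap.congr_fun this v

/-- The projection onto the kernel of `b`. -/
noncomputable def VNElem.kerProj (b : VNElem M) : VNElem M :=
  haveI : CompleteSpace (b : H →L[ℂ] H).ker :=
    (ContinuousLinearMap.isClosed_ker (b : H →L[ℂ] H)).completeSpace_coe
  ⟨(b : H →L[ℂ] H).ker.starProjection, by
    have h : IsStarProjection (b : H →L[ℂ] H).ker.starProjection :=
      isStarProjection_starProjection
    refine ((VonNeumannAlgebra.IsStarProjection.mem_iff h M).2 fun y hy => ?_ : _ ∈ M)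
    rw [Submodule.range_starProjection]
    intro v hv
    have := M.commute_of_mem b.2 hy
    have h2 := congrArg (fun T : H →L[ℂ] H => T v) this.eq
    have hv : (b : H →L[ℂ] H) v = 0 := hv
    simpa [hv] using h2⟩

theorem VNElem.apply_kerProj (b : VNElem M) (v : H) :
    (b : H →L[ℂ] H) ((b.kerProj : H →L[ℂ] H) v) = 0 :=
  haveI : CompleteSpace (b : H →L[ℂ] H).ker :=
    (ContinuousLinearMap.isClosed_ker (b : H →L[ℂ] H)).completeSpace_coe
  (b : H →L[ℂ] H).ker.starProjection_apply_mem v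

theorem VNElem.kerProj_apply_of_mem (b : VNElem M) {v : H} (hv : (b : H →L[ℂ] H) v = 0) :
    (b.kerProj : H →L[ℂ] H) v = v :=
  haveI : CompleteSpace (b : H →L[ℂ] H).ker :=
    (ContinuousLinearMap.isClosed_ker (b : H →L[ℂ] H)).completeSpace_coe
  Submodule.starProjection_eq_self_iff.2 hv

theorem VNElem.isStarProjection_iff_coe {p : VNElem M} :
    IsStarProjection p ↔ IsStarProjection (p : H →L[ℂ] H) := by
  simp only [isStarProjection_iff', Subtype.ext_iff]
  rfl

theorem VNElem.isStarProjection_kerProj (b : VNElem M) : IsStarProjection b.kerProj :=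
  haveI : CompleteSpace (b : H →L[ℂ] H).ker :=
    (ContinuousLinearMap.isClosed_ker (b : H →L[ℂ] H)).completeSpace_coe
  VNElem.isStarProjection_iff_coe.2 isStarProjection_starProjection

theorem VNElem.mul_kerProj (b : VNElem M) : b * b.kerProj = 0 :=
  Subtype.ext (ContinuousLinearMap.ext fun v => b.apply_kerProj v)

theorem VNElem.kerProj_mul {b x : VNElem M} (h : b * x = 0) : b.kerProj * x = x :=
  Subtype.ext <| ContinuousLinearMap.ext fun v => b.kerProj_apply_of_mem <|
    congrArg (fun T : VNElem M => (T : H →L[ℂ] H) v) h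

/-- An operator commuting with `b` leaves `ker b` invariant; invariance under both `x` and `star x`
makes the projection commute with `x`. -/
theorem VNElem.kerProj_commute {b x : VNElem M} (h : Commute b x) (h' : Commute b (star x)) :
    Commute b.kerProj x := by
  have key : ∀ y : VNElem M, Commute b y → b.kerProj * (y * b.kerProj) = y * b.kerProj :=
    fun y hy => VNElem.kerProj_mul (by rw [← mul_assoc, hy.eq, mul_assoc, b.mul_kerProj, mul_zero])
  have h1 := key x h
  have h2 := congrArg star (key _ h')
  simp only [star_mul, star_star, b.isStarProjection_kerProj.isSelfAdjoint.star_eq] at h2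
  rw [mul_assoc, h1] at h2
  exact h2.symm

theorem VNElem.eq_zero_of_mul_self_star {x : VNElem M} (h : star x * x = 0) : x = 0 :=
  CStarRing.star_mul_self_eq_zero_iff x |>.1 h

theorem VNElem.mul_eq_zero_of_conj_eq_zero {a p : VNElem M} (ha : 0 ≤ a)
    (h : star p * a * p = 0) : a * p = 0 := by
  obtain ⟨y, rfl⟩ := VNElem.nonneg_iff_exists.1 ha
  have : y * p = 0 := VNElem.eq_zero_of_mul_self_star (by rw [star_mul, ← h]; noncomm_ring)
  rw [mul_assoc, this, mul_zero]

theorem VNElem.conj_nonneg {a : VNElem M} (ha : 0 ≤ a) (c : VNElem M) : 0 ≤ star c * a * c :=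
  star_left_conjugate_nonneg ha c

theorem VNElem.conj_projection_nonneg {q a : VNElem M} (hq : IsStarProjection q) (ha : 0 ≤ a) :
    0 ≤ q * a * q := by
  have := VNElem.conj_nonneg ha q
  rwa [hq.isSelfAdjoint.star_eq] at this

end Algebra

/-! ### Null elements of positive functionals, strong limits, and faithfulness on the support. -/

section Functionals

variable {H : Type*} [NormedAddCommGroup H] [InnerProductSpace ℂ H] [CompleteSpace H]
  {M : VonNeumannAlgebra H}

attribute [local instance] VNElem.isClosed VNElem.starOrderedRing

theorem Complex.eq_zero_of_forall_nonneg_add_mul {a z : ℂ} (h : ∀ t : ℝ, 0 ≤ a + t * z) :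
    z = 0 := by
  have h0 := fun t => Complex.nonneg_iff.1 (h t)
  simp only [Complex.add_re, Complex.add_im, Complex.re_ofReal_mul, Complex.im_ofReal_mul] at h0
  refine Complex.ext ?_ ?_
  · by_contra hz
    have hz : z.re ≠ 0 := hz
    have := (h0 (-(a.re + 1) / z.re)).1
    rw [div_mul_cancel₀ _ hz] at this
    linarith
  · have h1 := (h0 0).2
    have h2 := (h0 1).2
    simp only [Complex.zero_im]
    linarith

/-- The null case of the Cauchy-Schwarz inequality. -/
theorem star_mul_null_of_null (f : VNElem M →ₗ[ℂ] ℂ)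
    (hf : ∀ x : VNElem M, 0 ≤ f (star x * x)) {y : VNElem M} (hy : f (star y * y) = 0)
    (x : VNElem M) : f (star x * y) = 0 ∧ f (star y * x) = 0 := by
  -- The term quadratic in `c` drops out because `f (star y * y) = 0`. What remains is affine along
  -- each real line, so positivity forces its slope to vanish; the directions `1` and `I` separate
  -- the two unknowns.
  have key : ∀ c : ℂ, 0 ≤ f (star x * x) + (c * f (star x * y) + star c * f (star y * x)) := by
    intro c
    have h := hf (x + c • y)
    have e : star (x + c • y) * (x + c • y) = star x * x + c • (star x * y)
        + star c • (star y * x) + (star c * c) • (star y * y) := by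
      simp only [star_add, star_smul, add_mul, mul_add, smul_mul_assoc, mul_smul_comm, smul_add]
      rw [smul_smul c (star c), mul_comm c (star c)]
      abel
    rw [e] at h
    simp only [map_add, map_smul, hy, smul_eq_mul, mul_zero, add_zero] at h
    rwa [add_assoc] at h
  have h1 : f (star x * y) + f (star y * x) = 0 := by
    refine Complex.eq_zero_of_forall_nonneg_add_mul (a := f (star x * x)) fun t => ?_
    have := key t
    rw [show star (t : ℂ) = t from Complex.conj_ofReal t] at this
    rwa [mul_add]
  have h2 : Complex.I * f (star x * y) - Complex.I * f (star y * x) = 0 := by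
    refine Complex.eq_zero_of_forall_nonneg_add_mul (a := f (star x * x)) fun t => ?_
    have := key (t * Complex.I)
    rw [show star ((t : ℂ) * Complex.I) = -(t * Complex.I) by
      simp] at this
    convert this using 2
    ring
  rw [← mul_sub, mul_eq_zero, or_iff_right Complex.I_ne_zero] at h2
  constructor
  · linear_combination (h1 + h2) / 2
  · linear_combination (h1 - h2) / 2

theorem mul_null_of_null (f : VNElem M →ₗ[ℂ] ℂ) (hf : ∀ x : VNElem M, 0 ≤ f (star x * x))
    {a : VNElem M} (ha : 0 ≤ a) (h : f a = 0) (x : VNElem M) : f (a * x) = 0 ∧ f (x * a) = 0 := by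
  obtain ⟨y, rfl⟩ := VNElem.nonneg_iff_exists.1 ha
  constructor
  · rw [mul_assoc]
    exact (star_mul_null_of_null f hf h (y * x)).2
  · rw [← mul_assoc]
    have := (star_mul_null_of_null f hf h (y * star x)).1
    rwa [star_mul, star_star] at this

/-- Normal functionals are continuous along bounded strongly convergent nets. -/
theorem IsNormalFunctional.tendsto {φ : StrongDual ℂ (VNElem M)} (hφ : IsNormalFunctional φ)
    {ι : Type*} {l : Filter ι} {T : ι → VNElem M} {S : VNElem M} {C : ℝ} (hC : ∀ i, ‖T i‖ ≤ C)
    (h : ∀ v : H, Tendsto (fun i => (T i : H →L[ℂ] H) v) l (𝓝 ((S : H →L[ℂ] H) v))) :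
    Tendsto (fun i => φ (T i)) l (𝓝 (φ S)) := by
  obtain ⟨ξ, η, hξ, hη, hφ⟩ := hφ
  simp only [hφ]
  refine tendsto_tsum_of_dominated_convergence
    (bound := fun n => |C| * (‖ξ n‖ ^ 2 + ‖η n‖ ^ 2)) ((hξ.add hη).mul_left _)
    (fun n => tendsto_const_nhds.inner (h (ξ n))) (Eventually.of_forall fun i n => ?_)
  have h1 : ‖(T i : H →L[ℂ] H) (ξ n)‖ ≤ |C| * ‖ξ n‖ :=
    (T i : H →L[ℂ] H).le_of_opNorm_le ((hC i).trans (le_abs_self C)) _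
  calc _ ≤ ‖η n‖ * ‖(T i : H →L[ℂ] H) (ξ n)‖ := norm_inner_le_norm _ _
    _ ≤ ‖η n‖ * (|C| * ‖ξ n‖) := by gcongr
    _ = |C| * (‖ξ n‖ * ‖η n‖) := by ring
    _ ≤ _ := by
      gcongr
      nlinarith [sq_nonneg (‖ξ n‖ - ‖η n‖), sq_nonneg (‖ξ n‖), sq_nonneg (‖η n‖)]

theorem IsNormalFunctional.tendsto_mul_right {φ : StrongDual ℂ (VNElem M)}
    (hφ : IsNormalFunctional φ) {ι : Type*} {l : Filter ι} {T : ι → VNElem M} {S : VNElem M}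
    {C : ℝ} (hC : ∀ i, ‖T i‖ ≤ C)
    (h : ∀ v : H, Tendsto (fun i => (T i : H →L[ℂ] H) v) l (𝓝 ((S : H →L[ℂ] H) v)))
    (x : VNElem M) : Tendsto (fun i => φ (T i * x)) l (𝓝 (φ (S * x))) :=
  hφ.tendsto (C := C * ‖x‖)
    (fun i => (norm_mul_le _ _).trans (mul_le_mul_of_nonneg_right (hC i) (norm_nonneg x)))
    fun v => h ((x : H →L[ℂ] H) v)

theorem IsNormalFunctional.tendsto_mul_left {φ : StrongDual ℂ (VNElem M)}
    (hφ : IsNormalFunctional φ) {ι : Type*} {l : Filter ι} {T : ι → VNElem M} {S : VNElem M}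
    {C : ℝ} (hC : ∀ i, ‖T i‖ ≤ C)
    (h : ∀ v : H, Tendsto (fun i => (T i : H →L[ℂ] H) v) l (𝓝 ((S : H →L[ℂ] H) v)))
    (x : VNElem M) : Tendsto (fun i => φ (x * T i)) l (𝓝 (φ (x * S))) :=
  hφ.tendsto (C := ‖x‖ * C)
    (fun i => (norm_mul_le _ _).trans (mul_le_mul_of_nonneg_left (hC i) (norm_nonneg x)))
    fun v => ((x : H →L[ℂ] H).continuous.tendsto _).comp (h v)

/-- The Cesàro means of the powers of `t`. -/
noncomputable def powerMean (t : VNElem M) (n : ℕ) : VNElem M :=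
  ((n : ℂ) + 1)⁻¹ • ∑ k ∈ Finset.range (n + 1), t ^ k

theorem norm_powerMean_le {t : VNElem M} (ht : ‖t‖ ≤ 1) (n : ℕ) : ‖powerMean t n‖ ≤ 1 := by
  have h1 : ∀ k, ‖t ^ k‖ ≤ 1 := by
    intro k
    induction k with
    | zero => 
      rw [pow_zero]
      exact ContinuousLinearMap.norm_id_le
    | succ k ih =>
      rw [pow_succ]
      exact (norm_mul_le _ _).trans (mul_le_one₀ ih (norm_nonneg _) ht)
  have h2 : ‖∑ k ∈ Finset.range (n + 1), t ^ k‖ ≤ n + 1 := by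
    refine (norm_sum_le_of_le _ fun k _ => h1 k).trans (le_of_eq ?_)
    simp
  have h3 : ‖((n : ℂ) + 1)‖ = n + 1 := by
    rw [← Nat.cast_succ, Complex.norm_natCast, Nat.cast_succ]
  rw [powerMean, norm_smul, norm_inv, h3, inv_mul_le_iff₀ (by positivity)]
  simpa using h2

/-- This is von Neumann's mean ergodic theorem for the contraction `1 - b`, whose fixed vectors form
`ker b`. -/
theorem tendsto_powerMean {b : VNElem M} (hb : ‖1 - b‖ ≤ 1) (v : H) :
    Tendsto (fun n => (powerMean (1 - b) n : H →L[ℂ] H) v) atTop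
      (𝓝 ((b.kerProj : H →L[ℂ] H) v)) := by
  have : CompleteSpace (b : H →L[ℂ] H).ker :=
    (ContinuousLinearMap.isClosed_ker (b : H →L[ℂ] H)).completeSpace_coe
  have h := (((1 - b : VNElem M) : H →L[ℂ] H).tendsto_birkhoffAverage_orthogonalProjection hb v).comp
    (tendsto_add_atTop_nat 1)
  have hU : (((1 - b : VNElem M) : H →L[ℂ] H) : H →ₗ[ℂ] H).eqLocus ((1 : H →L[ℂ] H) : H →ₗ[ℂ] H)
      = (b : H →L[ℂ] H).ker := by
    ext w
    simp [LinearMap.mem_eqLocus]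
  convert h using 1
  · funext n
    simp only [powerMean, Function.comp, birkhoffAverage, birkhoffSum, id]
    have : ∀ k w, ((1 - b : VNElem M) : H →L[ℂ] H)^[k] w
        = (((1 - b) ^ k : VNElem M) : H →L[ℂ] H) w := by
      intro k w
      induction k generalizing w with
      | zero => rfl
      | succ k ih => rw [Function.iterate_succ_apply, ih, pow_succ]; rfl
    simp only [this]
    simp
  · have gen : ∀ (U V : Submodule ℂ H) [U.HasOrthogonalProjection] [V.HasOrthogonalProjection],
        U = V → ((V.starProjection v : H)) = U.orthogonalProjectionOnto v := by
      rintro U V _ _ rfl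
      rfl
    exact congrArg 𝓝 (gen _ _ hU)

/-- If `φ` vanishes on the two-sided multiples of `b`, where `0 ≤ b ≤ 1`, then it vanishes on those of
the support of `b`. -/
theorem IsNormalFunctional.apply_kerProj {φ : StrongDual ℂ (VNElem M)} (hφ : IsNormalFunctional φ)
    {b : VNElem M} (hb : ‖1 - b‖ ≤ 1) (h : ∀ x, φ (b * x) = 0 ∧ φ (x * b) = 0) (x : VNElem M) :
    φ (x * b.kerProj) = φ x ∧ φ (b.kerProj * x) = φ x := by
  have hn : ∀ n : ℕ, ((n : ℂ) + 1) ≠ 0 := fun n => Nat.cast_add_one_ne_zero n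
  constructor
  -- Since `φ` vanishes on multiples of `b`, it does not distinguish powers of `1 - b` from `1`, nor
  -- therefore their means; the identity survives in the strong limit.
  · have h1 : ∀ k, φ (x * (1 - b) ^ k) = φ x := by
      intro k
      induction k with
      | zero => simp
      | succ k ih => rw [pow_succ, ← mul_assoc, mul_sub, map_sub, (h _).2, mul_one, ih, sub_zero]
    have h2 : ∀ n, φ (x * powerMean (1 - b) n) = φ x := by
      intro n
      rw [powerMean, mul_smul_comm, map_smul, Finset.mul_sum, map_sum]
      simp only [h1, Finset.sum_const, Finset.card_range, nsmul_eq_mul, smul_eq_mul]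
      push_cast
      rw [inv_mul_cancel_left₀ (hn n)]
    have h3 := hφ.tendsto_mul_left (fun n => norm_powerMean_le hb n) (tendsto_powerMean hb) x
    simp only [h2] at h3
    exact tendsto_nhds_unique h3 tendsto_const_nhds
  · have h1 : ∀ k, φ ((1 - b) ^ k * x) = φ x := by
      intro k
      induction k with
      | zero => simp
      | succ k ih => rw [pow_succ', mul_assoc, sub_mul, map_sub, (h _).1, one_mul, ih, sub_zero]
    have h2 : ∀ n, φ (powerMean (1 - b) n * x) = φ x := by
      intro n
      rw [powerMean, smul_mul_assoc, map_smul, Finset.sum_mul, map_sum]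
      simp only [h1, Finset.sum_const, Finset.card_range, nsmul_eq_mul, smul_eq_mul]
      push_cast
      rw [inv_mul_cancel_left₀ (hn n)]
    have h3 := hφ.tendsto_mul_right (fun n => norm_powerMean_le hb n) (tendsto_powerMean hb) x
    simp only [h2] at h3
    exact tendsto_nhds_unique h3 tendsto_const_nhds

theorem VNElem.norm_one_sub_le {b : VNElem M} (h0 : 0 ≤ b) (h1 : b ≤ 1) : ‖1 - b‖ ≤ 1 := by
  refine (CStarAlgebra.norm_le_iff_le_algebraMap (1 - b) zero_le_one (sub_nonneg.2 h1)).2 ?_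
  rw [map_one]
  exact sub_le_self 1 h0

/-- Faithfulness of a positive normal functional on the corner of its support. -/
theorem IsFunctionalSupport.mul_eq_zero {ρ : StrongDual ℂ (VNElem M)} (hn : IsNormalFunctional ρ)
    (hp : IsPositiveFunctional ρ) {e : VNElem M} (he : IsFunctionalSupport ρ e) {a : VNElem M}
    (ha : 0 ≤ a) (h : ρ a = 0) : a * e = 0 := by
  -- Rescaling brings `a` between `0` and `1`; the added `1` avoids a division by zero when `a = 0`.
  have hc : 0 ≤ (‖a‖ + 1)⁻¹ := by positivity
  set b : VNElem M := (‖a‖ + 1)⁻¹ • a with hb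
  have hb0 : 0 ≤ b := smul_nonneg hc ha
  have hb1 : b ≤ 1 := by
    have := IsSelfAdjoint.le_algebraMap_norm_self (a := a) (.of_nonneg ha)
    calc b ≤ (‖a‖ + 1)⁻¹ • algebraMap ℝ (VNElem M) ‖a‖ := smul_le_smul_of_nonneg_left this hc
      _ = algebraMap ℝ (VNElem M) ((‖a‖ + 1)⁻¹ * ‖a‖) := by
        rw [map_mul, Algebra.smul_def]
      _ ≤ algebraMap ℝ (VNElem M) 1 := by
        refine algebraMap_mono _ ?_
        rw [inv_mul_le_iff₀ (by positivity)]
        linarith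
      _ = 1 := map_one _
  have hb' : ρ b = 0 := by
    rw [hb, ← Complex.coe_smul, map_smul, h, smul_zero]
  have h1 := hn.apply_kerProj (VNElem.norm_one_sub_le hb0 hb1)
    (mul_null_of_null (ρ : VNElem M →ₗ[ℂ] ℂ) hp hb0 hb')
  -- `b.kerProj` competes in the definition of the support, so minimality puts `e` below it.
  have h2 : e ≤ b.kerProj := he.2 ⟨b.isStarProjection_kerProj, h1⟩
  have h3 := (IsStarProjection.le_iff_mul_eq_right he.1.1 b.isStarProjection_kerProj).1 h2
  have h4 : b * e = 0 := by rw [← h3, ← mul_assoc, b.mul_kerProj, zero_mul]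
  rw [hb, smul_mul_assoc] at h4
  exact (smul_eq_zero.1 h4).resolve_left (by positivity)

end Functionals

/-! ### Existence of supports. -/

section Support

variable {H : Type*} [NormedAddCommGroup H] [InnerProductSpace ℂ H] [CompleteSpace H]
  {M : VonNeumannAlgebra H}

attribute [local instance] VNElem.isClosed VNElem.starOrderedRing

theorem VNElem.kerProj_eq_one_sub {p : VNElem M} (hp : IsStarProjection p) :
    p.kerProj = 1 - p := by
  have h1 : p.kerProj * (1 - p) = 1 - p := VNElem.kerProj_mul hp.mul_one_sub_self
  have h2 : p.kerProj * p = 0 := by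
    have := congrArg star p.mul_kerProj
    rwa [star_mul, p.isStarProjection_kerProj.isSelfAdjoint.star_eq, hp.isSelfAdjoint.star_eq,
      star_zero] at this
  rwa [mul_sub, h2, mul_one, sub_zero] at h1

/-- Take for `r` the projection onto the kernel of the average `b` of `1 - p` and `1 - q`: a sum of
positive operators annihilates a vector only if both do, so `r` lies under `p` and `q`, while `φ`
vanishes on all multiples of `b`. -/
theorem IsFunctionalSupport.exists_le_le {φ : StrongDual ℂ (VNElem M)} (hφ : IsNormalFunctional φ)
    {p q : VNElem M} (hp : IsStarProjection p) (hq : IsStarProjection q)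
    (hp' : ∀ x, φ (x * p) = φ x ∧ φ (p * x) = φ x)
    (hq' : ∀ x, φ (x * q) = φ x ∧ φ (q * x) = φ x) :
    ∃ r : VNElem M, (IsStarProjection r ∧ ∀ x, φ (x * r) = φ x ∧ φ (r * x) = φ x) ∧
      r ≤ p ∧ r ≤ q := by
  set c : VNElem M := (1 - p) + (1 - q) with hc
  set b : VNElem M := (2⁻¹ : ℝ) • c with hb
  have hp0 : 0 ≤ 1 - p := sub_nonneg.2 hp.le_one
  have hq0 : 0 ≤ 1 - q := sub_nonneg.2 hq.le_one
  have hb0 : 0 ≤ b := smul_nonneg (by norm_num) (add_nonneg hp0 hq0)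
  have hb1 : b ≤ 1 := by
    have h1 : c ≤ (2 : ℝ) • (1 : VNElem M) := by
      rw [two_smul]
      exact add_le_add (sub_le_self 1 hp.nonneg) (sub_le_self 1 hq.nonneg)
    calc b ≤ (2⁻¹ : ℝ) • (2 : ℝ) • (1 : VNElem M) :=
          smul_le_smul_of_nonneg_left h1 (by norm_num)
      _ = 1 := by rw [smul_smul]; norm_num
  have hφb : ∀ x, φ (b * x) = 0 ∧ φ (x * b) = 0 := by
    intro x
    constructor
    · rw [hb, smul_mul_assoc, ← Complex.coe_smul, map_smul, hc, add_mul, sub_mul, sub_mul, map_add,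
        map_sub, map_sub, one_mul, (hp' x).2, (hq' x).2]
      simp
    · rw [hb, mul_smul_comm, ← Complex.coe_smul, map_smul, hc, mul_add, mul_sub, mul_sub, map_add,
        map_sub, map_sub, mul_one, (hp' x).1, (hq' x).1]
      simp
  set r := b.kerProj with hr
  have hrp : IsStarProjection r := b.isStarProjection_kerProj
  have hcr : star r * (1 - p) * r + star r * (1 - q) * r = 0 := by
    have h1 : b * r = 0 := b.mul_kerProj
    rw [hb, smul_mul_assoc] at h1
    have h2 : c * r = 0 := by
      have := congrArg (fun z => (2 : ℝ) • z) h1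
      rw [smul_smul, smul_zero] at this
      norm_num at this
      exact this
    rw [← add_mul, ← mul_add, mul_assoc, ← hc, h2, mul_zero]
  have h0 := (add_eq_zero_iff_of_nonneg (VNElem.conj_nonneg hp0 r) (VNElem.conj_nonneg hq0 r)).1 hcr
  have h1 := VNElem.mul_eq_zero_of_conj_eq_zero hp0 h0.1
  have h2 := VNElem.mul_eq_zero_of_conj_eq_zero hq0 h0.2
  rw [sub_mul, one_mul, sub_eq_zero] at h1 h2
  exact ⟨r, ⟨hrp, hφ.apply_kerProj (VNElem.norm_one_sub_le hb0 hb1) hφb⟩,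
    (IsStarProjection.le_iff_mul_eq_right hrp hp).2 h1.symm,
    (IsStarProjection.le_iff_mul_eq_right hrp hq).2 h2.symm⟩

/-- Every `σ`-weakly continuous functional has a support. -/
theorem IsNormalFunctional.exists_support {φ : StrongDual ℂ (VNElem M)}
    (hφ : IsNormalFunctional φ) : ∃ s, IsFunctionalSupport φ s := by
  set S : Set (VNElem M) := {p | IsStarProjection p ∧ ∀ x, φ (x * p) = φ x ∧ φ (p * x) = φ x}
    with hS
  have hdir : IsDirectedOrder (↥S)ᵒᵈ := ⟨fun p q => by
    obtain ⟨r, hr, hrp, hrq⟩ := IsFunctionalSupport.exists_le_le hφ (OrderDual.ofDual p).2.1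
      (OrderDual.ofDual q).2.1 (OrderDual.ofDual p).2.2 (OrderDual.ofDual q).2.2
    exact ⟨OrderDual.toDual ⟨r, hr⟩, hrp, hrq⟩⟩
  have hne : Nonempty (↥S)ᵒᵈ := ⟨OrderDual.toDual ⟨1, .one _, fun x => by simp⟩⟩
  have hcomplete : ∀ b : VNElem M, CompleteSpace (b : H →L[ℂ] H).ker := fun b =>
    (ContinuousLinearMap.isClosed_ker (b : H →L[ℂ] H)).completeSpace_coe
  -- The kernels grow as the projections decrease. The projections onto them converge strongly to
  -- the projection `Q` onto the closure `W` of their union, and `1 - Q` is the infimum of `S`.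
  let U : (↥S)ᵒᵈ → Submodule ℂ H := fun p => ((OrderDual.ofDual p).1 : H →L[ℂ] H).ker
  have hU : Monotone U := by
    intro p q hpq v hv
    have h1 : (OrderDual.ofDual q).1 ≤ (OrderDual.ofDual p).1 := hpq
    rw [IsStarProjection.le_iff_mul_eq_left (OrderDual.ofDual q).2.1 (OrderDual.ofDual p).2.1] at h1
    have h2 := congrArg (fun T : VNElem M => (T : H →L[ℂ] H) v) h1
    have hv : ((OrderDual.ofDual p).1 : H →L[ℂ] H) v = 0 := hv
    have h3 : ((OrderDual.ofDual q).1 : H →L[ℂ] H) (((OrderDual.ofDual p).1 : H →L[ℂ] H) v)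
        = ((OrderDual.ofDual q).1 : H →L[ℂ] H) v := h2
    rw [hv, map_zero] at h3
    exact h3.symm
  set W := (⨆ i, U i).topologicalClosure with hW
  have : CompleteSpace W := (Submodule.isClosed_topologicalClosure _).completeSpace_coe
  have hlim : ∀ v, Tendsto (fun i : (↥S)ᵒᵈ => ((OrderDual.ofDual i).1.kerProj : H →L[ℂ] H) v) atTop
      (𝓝 (W.starProjection v)) := fun v => Submodule.starProjection_tendsto_closure_iSup U hU v
  have hmem : W.starProjection ∈ M.toStarSubalgebra := by
    refine M.mem_of_forall_commute fun y hy => ContinuousLinearMap.ext fun v => ?_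
    refine tendsto_nhds_unique (hlim (y v)) (((y.continuous.tendsto _).comp (hlim v)).congr ?_)
    intro i
    exact congrArg (fun T : H →L[ℂ] H => T v)
      (M.commute_of_mem (OrderDual.ofDual i).1.kerProj.2 hy).eq.symm
  set Q : VNElem M := ⟨W.starProjection, hmem⟩
  have hQ : IsStarProjection Q := VNElem.isStarProjection_iff_coe.2 isStarProjection_starProjection
  have hk : ∀ i : (↥S)ᵒᵈ, (OrderDual.ofDual i).1.kerProj = 1 - (OrderDual.ofDual i).1 :=
    fun i => VNElem.kerProj_eq_one_sub (OrderDual.ofDual i).2.1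
  have hbd : ∀ i : (↥S)ᵒᵈ, ‖(OrderDual.ofDual i).1.kerProj‖ ≤ 1 := fun i =>
    IsStarProjection.norm_le _ (VNElem.isStarProjection_kerProj _)
  refine ⟨1 - Q, ⟨hQ.one_sub, fun x => ⟨?_, ?_⟩⟩, ?_⟩
  · have h1 := hφ.tendsto_mul_left (S := Q) hbd hlim x
    have h2 : φ (x * Q) = 0 := by
      refine tendsto_nhds_unique h1 (tendsto_const_nhds.congr fun i => ?_)
      rw [hk, mul_sub, mul_one, map_sub, ((OrderDual.ofDual i).2.2 x).1, sub_self]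
    rw [mul_sub, mul_one, map_sub, h2, sub_zero]
  · have h1 := hφ.tendsto_mul_right (S := Q) hbd hlim x
    have h2 : φ (Q * x) = 0 := by
      refine tendsto_nhds_unique h1 (tendsto_const_nhds.congr fun i => ?_)
      rw [hk, sub_mul, one_mul, map_sub, ((OrderDual.ofDual i).2.2 x).2, sub_self]
    rw [sub_mul, one_mul, map_sub, h2, sub_zero]
  · intro p hp
    have h1 : Q * (1 - p) = 1 - p := by
      refine Subtype.ext (ContinuousLinearMap.ext fun v => ?_)
      refine Submodule.starProjection_eq_self_iff.2 ?_
      refine Submodule.le_topologicalClosure _ ?_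
      refine Submodule.mem_iSup_of_mem (OrderDual.toDual ⟨p, hp⟩) ?_
      exact congrArg (fun T : VNElem M => (T : H →L[ℂ] H) v) hp.1.mul_one_sub_self
    rw [IsStarProjection.le_iff_mul_eq_left hQ.one_sub hp.1]
    rw [mul_sub, mul_one, sub_eq_iff_eq_add] at h1
    rw [sub_mul, one_mul]
    nth_rewrite 2 [h1]
    abel

end Support

/-! ### Trace functionals and projections of finite trace. -/

section Trace

variable {H : Type*} [NormedAddCommGroup H] [InnerProductSpace ℂ H] [CompleteSpace H]
  {M : VonNeumannAlgebra H}

attribute [local instance] VNElem.isClosed VNElem.starOrderedRing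

theorem VNElem.realPart_add_norm_nonneg (x : VNElem M) :
    0 ≤ (realPart x : VNElem M) + algebraMap ℝ (VNElem M) ‖x‖ := by
  have h1 := IsSelfAdjoint.neg_algebraMap_norm_le_self (a := (realPart x : VNElem M))
    (realPart x).2
  have h2 : algebraMap ℝ (VNElem M) ‖(realPart x : VNElem M)‖ ≤ algebraMap ℝ (VNElem M) ‖x‖ :=
    algebraMap_mono _ (realPart.norm_le x)
  have h3 := (neg_le_neg h2).trans h1
  exact neg_le_iff_add_nonneg.1 h3

theorem VNElem.realPart_le_norm (x : VNElem M) :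
    (realPart x : VNElem M) ≤ algebraMap ℝ (VNElem M) ‖x‖ :=
  (IsSelfAdjoint.le_algebraMap_norm_self (a := (realPart x : VNElem M)) (realPart x).2).trans
    (algebraMap_mono _ (realPart.norm_le x))

/-- An additive and positively homogeneous function on the positive cone extends to a bounded
linear functional. -/
theorem exists_strongDual_of_additive (f : VNElem M → ℝ)
    (hadd : ∀ x y : VNElem M, 0 ≤ x → 0 ≤ y → f (x + y) = f x + f y)
    (hsmul : ∀ c : ℝ, 0 ≤ c → f (algebraMap ℝ (VNElem M) c) = c * f 1)
    (hnonneg : ∀ x : VNElem M, 0 ≤ x → 0 ≤ f x) :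
    ∃ φ : StrongDual ℂ (VNElem M), ∀ x, 0 ≤ x → φ x = (f x : ℂ) := by
  set ι := algebraMap ℝ (VNElem M) with hι
  have hι0 : ∀ {c : ℝ}, 0 ≤ c → 0 ≤ ι c := fun hc => by
    rw [← map_zero ι]; exact algebraMap_mono _ hc
  have key : ∀ (a : VNElem M) (s t : ℝ), 0 ≤ s → 0 ≤ t → 0 ≤ a + ι s → 0 ≤ a + ι t →
      f (a + ι s) - s * f 1 = f (a + ι t) - t * f 1 := by
    intro a s t hs ht hs' ht'
    have h1 := hadd _ _ hs' (hι0 ht)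
    have h2 := hadd _ _ ht' (hι0 hs)
    rw [hsmul _ ht] at h1
    rw [hsmul _ hs] at h2
    rw [add_right_comm, h2] at h1
    linarith
  -- The real part is shifted into the positive cone and the shift is subtracted again; by `key` the
  -- result does not depend on the size of the shift, which yields additivity.
  let h : VNElem M → ℝ := fun x => f ((realPart x : VNElem M) + ι ‖x‖) - ‖x‖ * f 1
  have hh : ∀ x t, 0 ≤ t → 0 ≤ (realPart x : VNElem M) + ι t →
      h x = f ((realPart x : VNElem M) + ι t) - t * f 1 := fun x t ht ht' =>
    key _ _ _ (norm_nonneg x) ht x.realPart_add_norm_nonneg ht'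
  have h_add : ∀ x y, h (x + y) = h x + h y := by
    intro x y
    have e : ((realPart (x + y) : VNElem M)) + ι (‖x‖ + ‖y‖)
        = ((realPart x : VNElem M) + ι ‖x‖) + ((realPart y : VNElem M) + ι ‖y‖) := by
      rw [map_add, map_add, AddSubgroup.coe_add]
      abel
    have hx := x.realPart_add_norm_nonneg
    have hy := y.realPart_add_norm_nonneg
    rw [hh (x + y) (‖x‖ + ‖y‖) (by positivity) (by rw [e]; exact add_nonneg hx hy), e,
      hadd _ _ hx hy]
    ring
  have h_bound : ∀ x, ‖h x‖ ≤ f 1 * ‖x‖ := by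
    intro x
    have hx := x.realPart_add_norm_nonneg
    have h1 := hnonneg _ hx
    have hx2 : 0 ≤ ι ‖x‖ - (realPart x : VNElem M) := sub_nonneg.2 x.realPart_le_norm
    have h2 := hadd _ _ hx hx2
    have e : (realPart x : VNElem M) + ι ‖x‖ + (ι ‖x‖ - (realPart x : VNElem M))
        = ι (‖x‖ + ‖x‖) := by rw [map_add]; abel
    rw [e, hsmul _ (by positivity)] at h2
    have h3 := hnonneg _ hx2
    rw [Real.norm_eq_abs, abs_le]
    constructor
    · simp only [h]; linarith
    · simp only [h]; linarith
  let hHom : VNElem M →+ ℝ := AddMonoidHom.mk' h h_add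
  let L : VNElem M →L[ℝ] ℝ := hHom.toRealLinearMap
    (AddMonoidHomClass.continuous_of_bound hHom (f 1) h_bound)
  have hL : ∀ x, L x = h x := fun _ => rfl
  refine ⟨StrongDual.extendRCLike (𝕜 := ℂ) L, fun x hx => ?_⟩
  have h1 : h x = f x := by
    have hr : (realPart x : VNElem M) = x := (IsSelfAdjoint.of_nonneg hx).coe_realPart
    rw [hh x 0 le_rfl (by rw [map_zero, add_zero, hr]; exact hx)]
    simp [hr]
  -- The complex extension of `L` is `x ↦ L x - I * L (I • x)`; its second term must vanish at
  -- positive `x`.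
  have h2 : h (Complex.I • x) = 0 := by
    have hr : (realPart (Complex.I • x) : VNElem M) = 0 := by
      rw [realPart_I_smul, (IsSelfAdjoint.of_nonneg hx).imaginaryPart]
      simp
    have e := hadd 0 0 le_rfl le_rfl
    rw [hh _ 0 le_rfl (by rw [map_zero, add_zero, hr])]
    simp only [hr, map_zero, add_zero] at e ⊢
    linarith
  rw [StrongDual.extendRCLike_apply, hL, hL]
  simp only [RCLike.I_to_complex, h1, h2]
  simp

namespace FNSTrace

theorem mono (τ : FNSTrace M) {x y : VNElem M} (hx : 0 ≤ x) (hxy : x ≤ y) :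
    τ.toFun x ≤ τ.toFun y := by
  have := τ.map_add x (y - x) hx (sub_nonneg.2 hxy)
  rw [add_sub_cancel] at this
  rw [this]
  exact le_self_add

theorem toFun_smul (τ : FNSTrace M) {c : ℝ} (hc : 0 ≤ c) {x : VNElem M} (hx : 0 ≤ x) :
    τ.toFun (c • x) = ENNReal.ofReal c * τ.toFun x := by
  have := τ.map_smul ⟨c, hc⟩ x hx
  rw [← Complex.coe_smul]
  rw [ENNReal.ofReal_eq_coe_nnreal hc]
  exact this

theorem toFun_zero (τ : FNSTrace M) : τ.toFun 0 = 0 := by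
  have := τ.toFun_smul le_rfl (le_refl (0 : VNElem M))
  simpa using this

theorem conj_lt_top (τ : FNSTrace M) {p x : VNElem M} (hp : IsStarProjection p)
    (hτ : τ.toFun p < ∞) (hx : 0 ≤ x) : τ.toFun (p * x * p) < ∞ := by
  have h1 : p * x * p ≤ ‖x‖ • p := by
    have := star_left_conjugate_le_conjugate (IsSelfAdjoint.le_algebraMap_norm_self
      (a := x) (.of_nonneg hx)) p
    rw [hp.isSelfAdjoint.star_eq] at this
    refine this.trans (le_of_eq ?_)
    rw [← Algebra.commutes, mul_assoc, hp.isIdempotentElem.eq, Algebra.smul_def]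
  have h0 : 0 ≤ p * x * p := VNElem.conj_projection_nonneg hp hx
  refine (τ.mono h0 h1).trans_lt ?_
  rw [τ.toFun_smul (norm_nonneg x) hp.nonneg]
  exact ENNReal.mul_lt_top ENNReal.ofReal_lt_top hτ

/-- `toReal` preserves additivity because `p x p ≤ ‖x‖ p` keeps all traces finite. -/
theorem exists_isTraceFunctional (τ : FNSTrace M) {p : VNElem M} (hp : IsStarProjection p)
    (hτ : τ.toFun p < ∞) : ∃ φ, IsTraceFunctional τ p φ := by
  have h0 : ∀ {x : VNElem M}, 0 ≤ x → 0 ≤ p * x * p := VNElem.conj_projection_nonneg hp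
  refine exists_strongDual_of_additive (fun x => (τ.toFun (p * x * p)).toReal) ?_ ?_ ?_
  · intro x y hx hy
    rw [mul_add, add_mul, τ.map_add _ _ (h0 hx) (h0 hy),
      ENNReal.toReal_add (τ.conj_lt_top hp hτ hx).ne (τ.conj_lt_top hp hτ hy).ne]
  · intro c hc
    rw [Algebra.algebraMap_eq_smul_one, mul_smul_comm, smul_mul_assoc,
      τ.toFun_smul hc (h0 zero_le_one), ENNReal.toReal_mul, ENNReal.toReal_ofReal hc]
  · exact fun x _ => ENNReal.toReal_nonneg

/-- A positive element `y` of finite trace dominates a multiple of a projection of finite trace. -/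
theorem exists_projection_smul_le (τ : FNSTrace M) {y : VNElem M} (hy : 0 ≤ y) (hy0 : y ≠ 0)
    (hτ : τ.toFun y < ∞) : ∃ (p : VNElem M) (ε : ℝ), IsStarProjection p ∧ p ≠ 0 ∧ τ.toFun p < ∞ ∧
      0 < ε ∧ ε • p ≤ y := by
  -- The projection sought is the spectral projection of `y` for `(ε, ∞)`, obtained as the support
  -- of the positive part of `y - ε`. Any `ε` strictly between `0` and `‖y‖` would do: if `p` were
  -- `0`, then `y ≤ ε`, hence `‖y‖ ≤ ε`.
  set ε : ℝ := ‖y‖ / 2 with hε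
  have hy1 : 0 < ‖y‖ := norm_pos_iff.2 hy0
  have hε0 : 0 < ε := by positivity
  set w : VNElem M := y - algebraMap ℝ (VNElem M) ε with hw
  have hysa : IsSelfAdjoint y := .of_nonneg hy
  have hwsa : IsSelfAdjoint w := hysa.sub (.algebraMap _ (.all ε))
  have hcd : w⁺ - w⁻ = w := CFC.posPart_sub_negPart w hwsa
  have hmul : w⁺ * w⁻ = 0 := CFC.posPart_mul_negPart w
  have hc0 : 0 ≤ w⁺ := CFC.posPart_nonneg w
  have hd0 : 0 ≤ w⁻ := CFC.negPart_nonneg w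
  set k := VNElem.kerProj (w⁺) with hk
  have hkp : IsStarProjection k := VNElem.isStarProjection_kerProj _
  obtain ⟨p, hpk⟩ : ∃ p, p = 1 - k := ⟨_, rfl⟩
  have hpp : IsStarProjection p := hpk ▸ hkp.one_sub
  have hpd : p * w⁻ = 0 := by
    rw [hpk, sub_mul, one_mul, VNElem.kerProj_mul hmul, sub_self]
  have hyw : y = algebraMap ℝ (VNElem M) ε + w⁺ - w⁻ := by
    rw [add_sub_assoc, hcd, hw]; abel
  have hcw : Commute (w⁺) w := by
    nth_rewrite 2 [← hcd]
    refine (Commute.refl _).sub_right ?_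
    exact hmul.trans (CFC.negPart_mul_posPart w).symm
  have hcy : Commute (w⁺) y := by
    have : y = w + algebraMap ℝ (VNElem M) ε := by rw [hw]; abel
    rw [this]
    exact hcw.add_right (Algebra.commutes _ _).symm
  have hky : Commute k y := VNElem.kerProj_commute hcy (by rwa [hysa.star_eq])
  have hle : ε • p ≤ y := by
    have h1 : p * y * p = ε • p + p * w⁺ * p := by
      nth_rewrite 1 [hyw]
      rw [mul_sub, mul_add, hpd, sub_zero, add_mul, ← Algebra.commutes, mul_assoc,
        hpp.isIdempotentElem.eq, Algebra.smul_def]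
    have h2 : y = p * y * p + k * y * k := by
      have hk2 := hkp.isIdempotentElem.eq
      have e1 : k * y * k = k * y := by rw [hky.eq, mul_assoc, hk2]
      have e2 : y * k = k * y := hky.eq.symm
      have e3 : p * y * p = y - k * y := by
        rw [hpk]
        simp only [sub_mul, mul_sub, one_mul, mul_one, e1, e2]
        abel
      rw [e1, e3]; abel
    calc ε • p ≤ ε • p + p * w⁺ * p :=
          le_add_of_nonneg_right (VNElem.conj_projection_nonneg hpp hc0)
      _ = p * y * p := h1.symm
      _ ≤ p * y * p + k * y * k := le_add_of_nonneg_right (VNElem.conj_projection_nonneg hkp hy)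
      _ = y := h2.symm
  refine ⟨p, ε, hpp, ?_, ?_, hε0, hle⟩
  · intro hp0
    have hk1 : k = 1 := (sub_eq_zero.1 (hpk ▸ hp0)).symm
    have hc : w⁺ = 0 := by
      have := VNElem.mul_kerProj (w⁺)
      rwa [← hk, hk1, mul_one] at this
    have h1 : y ≤ algebraMap ℝ (VNElem M) ε := by
      rw [hyw, hc, add_zero]
      exact sub_le_self _ hd0
    have := (CStarAlgebra.norm_le_iff_le_algebraMap y hε0.le hy).2 h1
    linarith
  · have h1 := τ.mono (smul_nonneg hε0.le hpp.nonneg) hle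
    rw [τ.toFun_smul hε0.le hpp.nonneg] at h1
    by_contra hcon
    rw [not_lt, top_le_iff] at hcon
    rw [hcon, ENNReal.mul_top (by simpa using hε0)] at h1
    exact absurd hτ (not_lt.2 h1)

/-- A corner of a positive element vanishes if all its compressions to subprojections of finite
trace do. -/
theorem conj_eq_zero_of_forall_finite (τ : FNSTrace M) {b e : VNElem M} (hb : 0 ≤ b)
    (he : IsStarProjection e)
    (h : ∀ p : VNElem M, IsStarProjection p → p * e = p → τ.toFun p < ∞ → p * b * p = 0) :
    e * b * e = 0 := by
  by_contra hne
  obtain ⟨y, hy0, hya, hyne, hyτ⟩ := τ.semifinite _ (VNElem.conj_projection_nonneg he hb) hne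
  obtain ⟨p, ε, hp, hpne, hpτ, hε, hpy⟩ := τ.exists_projection_smul_le hy0 hyne hyτ
  have hpa : ε • p ≤ e * b * e := hpy.trans hya
  have hε' : ∀ {z : VNElem M}, ε • z ≤ 0 → z ≤ 0 := fun {z} hz => by
    have := smul_le_smul_of_nonneg_left hz (inv_nonneg.2 hε.le)
    rwa [smul_smul, inv_mul_cancel₀ hε.ne', one_smul, smul_zero] at this
  -- Compressing `ε • p ≤ e * b * e` by `1 - e` kills the right side, so `p ≤ e` and the hypothesis
  -- covers `p`. Compressing by `p` then gives `ε • p ≤ p * b * p = 0`, a contradiction.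
  have hpe : p * (1 - e) = 0 := by
    refine VNElem.mul_eq_zero_of_conj_eq_zero hp.nonneg
      (le_antisymm ?_ (VNElem.conj_nonneg hp.nonneg _))
    have h1 := star_left_conjugate_le_conjugate hpa (1 - e)
    have h2 : star (1 - e) * (e * b * e) * (1 - e) = 0 := by
      rw [mul_assoc, mul_assoc (e * b), he.mul_one_sub_self, mul_zero, mul_zero]
    rw [h2, mul_smul_comm, smul_mul_assoc] at h1
    exact hε' h1
  rw [mul_sub, mul_one, sub_eq_zero] at hpe
  have hep : e * p = p := by
    have := congrArg star hpe
    rw [star_mul, hp.isSelfAdjoint.star_eq, he.isSelfAdjoint.star_eq] at this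
    exact this.symm
  have h1 := star_left_conjugate_le_conjugate hpa p
  have h2 : star p * (e * b * e) * p = 0 := by
    rw [hp.isSelfAdjoint.star_eq, ← h p hp hpe.symm hpτ]
    calc p * (e * b * e) * p = (p * e) * b * (e * p) := by noncomm_ring
      _ = _ := by rw [← hpe, hep]
  rw [h2, mul_smul_comm, smul_mul_assoc, hp.isSelfAdjoint.star_eq, hp.isIdempotentElem.eq,
    hp.isIdempotentElem.eq] at h1
  exact hpne (le_antisymm (hε' h1) hp.nonneg)

end FNSTrace

end Trace

/-! ### Vanishing corners of positive maps and functionals. -/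

section Corners

variable {H : Type*} [NormedAddCommGroup H] [InnerProductSpace ℂ H] [CompleteSpace H]
  {M : VonNeumannAlgebra H}

attribute [local instance] VNElem.isClosed VNElem.starOrderedRing

/-- A positive contraction vanishing on the projection `e` is at most `1 - e`. -/
theorem VNElem.le_one_sub_of_mul_eq_zero {a e : VNElem M} (he : IsStarProjection e) (ha : 0 ≤ a)
    (ha1 : a ≤ 1) (h : a * e = 0) : a ≤ 1 - e := by
  have h' : e * a = 0 := by
    have := congrArg star h
    rwa [star_mul, he.isSelfAdjoint.star_eq, (IsSelfAdjoint.of_nonneg ha).star_eq,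
      star_zero] at this
  have h1 := star_left_conjugate_le_conjugate ha1 (1 - e)
  rw [he.one_sub.isSelfAdjoint.star_eq, mul_one, he.one_sub.isIdempotentElem.eq, mul_sub,
    sub_mul, h', mul_one, one_mul, sub_zero, h, sub_zero] at h1
  exact h1

theorem IsNormalFunctional.compress {φ : StrongDual ℂ (VNElem M)} (hφ : IsNormalFunctional φ)
    (e f : VNElem M) : IsNormalFunctional (compress e f φ) := by
  obtain ⟨ξ, η, hξ, hη, hφ⟩ := hφ
  refine ⟨fun n => (e : H →L[ℂ] H) (ξ n), fun n => (star (f : H →L[ℂ] H)) (η n), ?_, ?_, ?_⟩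
  · refine Summable.of_nonneg_of_le (fun n => by positivity) (fun n => ?_)
      (hξ.mul_left (‖(e : H →L[ℂ] H)‖ ^ 2))
    rw [← mul_pow]
    gcongr
    exact (e : H →L[ℂ] H).le_opNorm _
  · refine Summable.of_nonneg_of_le (fun n => by positivity) (fun n => ?_)
      (hη.mul_left (‖star (f : H →L[ℂ] H)‖ ^ 2))
    rw [← mul_pow]
    gcongr
    exact (star (f : H →L[ℂ] H)).le_opNorm _
  · intro x
    have h1 : _root_.compress e f φ x = φ (f * (x * e)) := rfl
    rw [h1, hφ]
    refine tsum_congr fun n => ?_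
    rw [ContinuousLinearMap.star_eq_adjoint, ContinuousLinearMap.adjoint_inner_left]
    rfl

/-- If the corner `e T(p) e` of the image of a projection `p` under a positive map `T` vanishes,
then so do the corners of the images of all multiples of `p`. -/
theorem conj_map_mul_eq_zero (T : VNElem M →L[ℂ] VNElem M) (hT : ∀ x, 0 ≤ x → 0 ≤ T x)
    {e p : VNElem M} (he : IsStarProjection e) (hp : 0 ≤ p) (h : e * T p * e = 0) (x : VNElem M) :
    e * T (p * x) * e = 0 ∧ e * T (x * p) * e = 0 := by
  have key : ∀ v : H, ∃ f : VNElem M →ₗ[ℂ] ℂ,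
      ∀ y, f y = inner ℂ v (((e * T y * e : VNElem M) : H →L[ℂ] H) v) := fun v =>
    ⟨{ toFun := fun y => inner ℂ v (((e * T y * e : VNElem M) : H →L[ℂ] H) v)
       map_add' := fun y z => by
        rw [map_add, mul_add, add_mul]
        exact inner_add_right _ _ _
       map_smul' := fun c y => by
        rw [map_smul, mul_smul_comm, smul_mul_assoc]
        exact inner_smul_right _ _ _ }, fun _ => rfl⟩
  have hz : ∀ v : H, ∀ y : VNElem M, (y = p * x ∨ y = x * p) →
      inner ℂ (((e * T y * e : VNElem M) : H →L[ℂ] H) v) v = 0 := by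
    intro v y hy
    obtain ⟨f, hf⟩ := key v
    have hpos : ∀ z : VNElem M, 0 ≤ f (star z * z) := by
      intro z
      have h1 := VNElem.conj_projection_nonneg he (hT _ (star_mul_self_nonneg z))
      rw [hf]
      exact ((ContinuousLinearMap.nonneg_iff_isPositive _).1 h1).inner_nonneg_right v
    have hfp : f p = 0 := by
      rw [hf, h]
      exact inner_zero_right _
    have h0 := mul_null_of_null f hpos hp hfp x
    rw [← inner_conj_symm, ← hf]
    rcases hy with rfl | rfl
    · rw [h0.1, map_zero]
    · rw [h0.2, map_zero]
  exact ⟨VNElem.eq_zero_of_forall_inner fun v => hz v _ (.inl rfl),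
    VNElem.eq_zero_of_forall_inner fun v => hz v _ (.inr rfl)⟩

/-- A functional is unchanged by compression to its support. -/
theorem IsFunctionalSupport.apply_conj {ρ : StrongDual ℂ (VNElem M)} {e : VNElem M}
    (he : IsFunctionalSupport ρ e) (a : VNElem M) : ρ (e * a * e) = ρ a := by
  rw [(he.1.2 _).1, (he.1.2 _).2]

/-- Faithfulness of `τ` applies once the value `∞`, which `toReal` also sends to `0`, is excluded by
`τ(p) < ∞`. -/
theorem IsTraceFunctional.apply_eq_zero_iff {τ : FNSTrace M} {p : VNElem M}
    {φ : StrongDual ℂ (VNElem M)} (hp : IsStarProjection p) (hτ : τ.toFun p < ∞)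
    (hφ : IsTraceFunctional τ p φ) {x : VNElem M} (hx : 0 ≤ x) (h : φ x = 0) :
    p * x * p = 0 := by
  have h0 : 0 ≤ p * x * p := VNElem.conj_projection_nonneg hp hx
  have h1 := (hφ x hx).symm.trans h
  rw [Complex.ofReal_eq_zero, ENNReal.toReal_eq_zero_iff] at h1
  exact τ.faithful _ h0 (h1.resolve_right (τ.conj_lt_top hp hτ hx).ne)

end Corners

/-! ### The invariance statements. -/

theorem proposition3p12
    {H : Type*} [NormedAddCommGroup H] [InnerProductSpace ℂ H] [CompleteSpace H]
    [TopologicalSpace.SeparableSpace H]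
    (M : VonNeumannAlgebra H) (τ : FNSTrace M)
    {G : Type*} [Semigroup G] [TopologicalSpace G] [ContinuousMul G] [LocallyCompactSpace G]
    [SecondCountableTopology G] [T2Space G] [MeasurableSpace G] [BorelSpace G]
    (m : Measure G) [SigmaFinite m] (hm : IsTwoSidedInvariant m)
    (K : ℕ → Set G) (hK : IsFolnerSequence m K)
    (α : G → VNElem M →L[ℂ] VNElem M) (hα : IsNCDynamicalSystem α)
    (e₁ e₂ : VNElem M) (he : IsNeveuDecomposition m K α e₁ e₂) :
    (∀ g, α g e₂ ≤ e₂) ∧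
    (∀ (X : StrongDual ℂ (VNElem M)), IsNormalFunctional X → ∀ g,
      ∃ s : VNElem M, IsFunctionalSupport (dualMap (α g) (compress e₁ e₁ X)) s ∧ s ≤ e₁) ∧
    ((∀ g, dualMap (α g) ∈ lampertiClass τ) → ∀ g, α g e₁ ≤ e₁) := by
  have := VNElem.isClosed M
  have : StarOrderedRing (VNElem M) := VNElem.starOrderedRing
  obtain ⟨ρ, hρn, hρp, hρi, hρs⟩ := he.exists_invariant
  have he₁ : IsStarProjection e₁ := hρs.1.1
  have he₂ : e₂ = 1 - e₁ := eq_sub_of_add_eq' he.add_eq_one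
  have he₂p : IsStarProjection e₂ := he₂ ▸ he₁.one_sub
  have h12 : e₁ * e₂ = 0 := by rw [he₂, he₁.mul_one_sub_self]
  have hρe₂ : ρ e₂ = 0 := by
    have := (hρs.1.2 1).1
    rw [one_mul] at this
    rw [he₂, map_sub, this, sub_self]
  have hle : ∀ g {p : VNElem M}, IsStarProjection p → α g p ≤ 1 := fun g p hp => by
    have := hα.positive g _ (sub_nonneg.2 hp.le_one)
    rw [map_sub] at this
    exact (sub_nonneg.1 this).trans (hα.map_one_le g)
  have hwander : ∀ g, α g e₂ * e₁ = 0 := fun g =>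
    hρs.mul_eq_zero hρn hρp (hα.positive g _ he₂p.nonneg) (by rw [hρi, hρe₂])
  refine ⟨fun g => ?_, fun X hX g => ?_, fun hL g => ?_⟩
  · rw [he₂] at hwander ⊢
    exact VNElem.le_one_sub_of_mul_eq_zero he₁ (hα.positive g _ he₁.one_sub.nonneg)
      (hle g he₁.one_sub) (hwander g)
  · obtain ⟨s, hs⟩ := (hα.normal g _ (hX.compress e₁ e₁)).exists_support
    refine ⟨s, hs, hs.2 ⟨he₁, fun x => ?_⟩⟩
    have h0 := conj_map_mul_eq_zero (α g) (hα.positive g) he₁ he₂p.nonneg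
      (by rw [mul_assoc, hwander g, mul_zero]) x
    have hval : ∀ y, dualMap (α g) (compress e₁ e₁ X) y = X (e₁ * α g y * e₁) := fun y =>
      congrArg X (mul_assoc _ _ _).symm
    rw [he₂, sub_mul, mul_sub, map_sub, map_sub, one_mul, mul_one, mul_sub, mul_sub, sub_mul,
      sub_mul, sub_eq_zero, sub_eq_zero] at h0
    exact ⟨(hval _).trans ((congrArg X h0.2.symm).trans (hval _).symm),
      (hval _).trans ((congrArg X h0.1.symm).trans (hval _).symm)⟩
  · have hcorner : e₂ * α g e₁ * e₂ = 0 := by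
      refine τ.conj_eq_zero_of_forall_finite (hα.positive g _ he₁.nonneg) he₂p
        fun q hq hqe hqτ => ?_
      obtain ⟨ψ, hψ⟩ := τ.exists_isTraceFunctional hq hqτ
      have hpair : ∀ p : VNElem M, IsStarProjection p → p * e₁ = p → τ.toFun p < ∞ →
          ∀ φ, IsTraceFunctional τ p φ →
            HaveZeroProduct (dualMap (α g) φ) (dualMap (α g) ψ) := by
        intro p hp hpe hpτ φ hφ
        refine (hL g).2.2.2 p q hp hq hpτ hqτ ?_ φ ψ hφ hψ
        have hqe' : e₂ * q = q := by
          have := congrArg star hqe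
          rwa [star_mul, hq.isSelfAdjoint.star_eq, he₂p.isSelfAdjoint.star_eq] at this
        rw [← hpe, ← hqe', mul_assoc, ← mul_assoc e₁, h12, zero_mul, mul_zero]
      -- The Lamperti condition itself asserts that the supports exist; pairing `q` with the
      -- projection `0` extracts the one needed here.
      obtain ⟨t, ht⟩ : ∃ t, IsFunctionalSupport (dualMap (α g) ψ) t := by
        have h0τ : τ.toFun 0 < ∞ := by rw [τ.toFun_zero]; exact ENNReal.zero_lt_top
        obtain ⟨φ, hφ⟩ := τ.exists_isTraceFunctional (.zero _) h0τ
        obtain ⟨s, t, -, ht, -⟩ := hpair 0 (.zero _) (zero_mul _) h0τ φ hφ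
        exact ⟨t, ht⟩
      have htpos := ht.1.1.nonneg
      have hαt : e₁ * α g t * e₁ = 0 := by
        refine τ.conj_eq_zero_of_forall_finite (hα.positive g _ htpos) he₁
          fun p hp hpe hpτ => ?_
        obtain ⟨φ, hφ⟩ := τ.exists_isTraceFunctional hp hpτ
        obtain ⟨s, t', hs, ht', hst⟩ := hpair p hp hpe hpτ φ hφ
        -- Supports are unique, so a single `t` serves every `p`; then `φ (α g t)` equals the value
        -- of `α_g^*(φ)` at `s * t = 0`.
        obtain rfl := ht.unique ht'
        refine hφ.apply_eq_zero_iff hp hpτ (hα.positive g _ htpos) ?_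
        have h1 := (hs.1.2 t).2
        rw [hst, map_zero] at h1
        exact h1.symm
      have hρt : ρ t = 0 := by
        rw [← hρi g, ← hρs.apply_conj, hαt, map_zero]
      have hte : t * e₁ = 0 := hρs.mul_eq_zero hρn hρp htpos hρt
      refine hψ.apply_eq_zero_iff hq hqτ (hα.positive g _ he₁.nonneg) ?_
      have h1 := (ht.1.2 e₁).2
      rw [hte, map_zero] at h1
      exact h1.symm
    have h2 : α g e₁ * e₂ = 0 :=
      VNElem.mul_eq_zero_of_conj_eq_zero (hα.positive g _ he₁.nonneg)
        (by rw [he₂p.isSelfAdjoint.star_eq, hcorner])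
    have h3 := VNElem.le_one_sub_of_mul_eq_zero he₂p (hα.positive g _ he₁.nonneg) (hle g he₁) h2
    rwa [he₂, sub_sub_cancel] at h3
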